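/- Let $X$ be a Tychonoff space with Stone–Čech compactification $\beta X$, and let $\upsilon X\subseteq\beta X$ be its Hewitt realcompactification, i.e. the set of all $p\in\beta X$ such that for every continuous $f:X\to\mathbb{R}$ the continuous extension $\beta X\to\mathbb{R}\cup\{\infty\}$ of $f$ is finite at $p$. Define the subspaces \[\alpha X=X\cup(\beta X\setminus\upsilon X),\qquad \zeta X=X\cup\mathrm{cl}_{\beta X}(\beta X\setminus\upsilon X)\] of $\beta X$. A space is pseudocompact if every continuous real-valued function on it is bounded; zero-sets and cozero-sets of $X$ are the sets $\{x: f(x)=0\}$ and $\{x: f(x)\neq 0\}$ with $f:X\to\mathbb{R}$ continuous; a $z$-ultrafilter in $X$ is a maximal proper filter of zero-sets of $X$, and it is free if its intersection is empty. Then: (1) $\zeta X=X$ if and only if $X$ is pseudocompact. (2) $\zeta X=\beta X$ if and only if there exists no cozero-set of $X$ with pseudocompact closure (in $X$) containing a non-compact zero-set of $X$. (3) The following are equivalent: (a) $\zeta X=\alpha X$; (b) $\upsilon X\setminus X\subseteq\mathrm{int}_{\beta X}\upsilon X$; (c) every free $z$-ultrafilter in $X$ with the countable intersection property has an element contained in a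 cozero-set of $X$ with pseudocompact closure. -/

import Mathlib

universe u

/-- A space is pseudocompact if every continuous real-valued function on it is bounded. -/
def IsPseudocompactSpace (X : Type u) [TopologicalSpace X] : Prop :=
  ∀ f : C(X, ℝ), Bornology.IsBounded (Set.range f)

/-- A zero-set of `X`. -/
def IsZeroSet {X : Type u} [TopologicalSpace X] (Z : Set X) : Prop :=
  ∃ f : C(X, ℝ), Z = {x | f x = 0}

/-- A cozero-set of `X`. -/
def IsCozeroSet {X : Type u} [TopologicalSpace X] (C : Set X) : Prop :=
  ∃ f : C(X, ℝ), C = {x | f x ≠ 0}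

/-- A cozero-set of `X` whose closure in `X`, with the subspace topology, is pseudocompact. -/
def IsCozeroSetWithPseudocompactClosure {X : Type u} [TopologicalSpace X] (C : Set X) : Prop :=
  IsCozeroSet C ∧ IsPseudocompactSpace (closure C)

/-- A (proper) z-filter in `X`: a nonempty family of nonempty zero-sets of `X`, closed under
finite intersections and under passing to larger zero-sets. -/
structure IsZFilter {X : Type u} [TopologicalSpace X] (F : Set (Set X)) : Prop where
  isZeroSet : ∀ Z ∈ F, IsZeroSet Z
  nonempty : F.Nonempty
  empty_notMem : ∅ ∉ F
  inter_mem : ∀ Z ∈ F, ∀ W ∈ F, Z ∩ W ∈ F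
  mem_of_superset : ∀ Z ∈ F, ∀ W, IsZeroSet W → Z ⊆ W → W ∈ F

/-- A z-ultrafilter in `X`: a z-filter that is maximal under inclusion. -/
def IsZUltrafilter {X : Type u} [TopologicalSpace X] (F : Set (Set X)) : Prop :=
  Maximal IsZFilter F

/-- A family of sets is free if its intersection is empty. -/
def IsFreeFamily {X : Type u} (F : Set (Set X)) : Prop :=
  ⋂₀ F = ∅

/-- The countable intersection property. -/
def HasCountableIntersectionProperty {X : Type u} (F : Set (Set X)) : Prop :=
  ∀ S : Set (Set X), S ⊆ F → S.Countable → (⋂₀ S).Nonempty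

section Extensions

variable (X : Type u) [TopologicalSpace X]

/-- The canonical copy of `X` in its Stone–Čech compactification `βX`. -/
def copyInBeta : Set (StoneCech X) :=
  Set.range (stoneCechUnit : X → StoneCech X)

variable {X} in
/-- The Stone extension `βX → ℝ ∪ {∞}` of a continuous function `f : X → ℝ`, where
`ℝ ∪ {∞}` is the one-point compactification of `ℝ`. -/
noncomputable def stoneExtension (f : C(X, ℝ)) : StoneCech X → OnePoint ℝ :=
  stoneCechExtend (g := fun x => (f x : OnePoint ℝ))
    (OnePoint.continuous_coe.comp f.continuous)

/-- The Hewitt realcompactification `υX` as a subspace of `βX`: the points at which the Stone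
extension of every continuous real-valued function on `X` is finite. -/
def hewittRealcompactification : Set (StoneCech X) :=
  {p | ∀ f : C(X, ℝ), stoneExtension f p ≠ OnePoint.infty}

/-- `αX = X ∪ (βX \ υX)`, as a subspace of `βX`. -/
def alphaExtension : Set (StoneCech X) :=
  copyInBeta X ∪ (hewittRealcompactification X)ᶜ

/-- `ζX = X ∪ cl_{βX} (βX \ υX)`, as a subspace of `βX`. -/
def zetaExtension : Set (StoneCech X) :=
  copyInBeta X ∪ closure (hewittRealcompactification X)ᶜ

end Extensions

open Set Filter Topology

/-! ### Finiteness of Stone extensions and traces on `X` of neighbourhoods in `βX`. -/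

section StoneExtension

variable {X : Type u} [TopologicalSpace X]

/-! Since `cl(βX \ υX)` is the complement of `int υX`, everything rests on describing `int υX`: it
is the union of the `βX`-closures of zero-sets lying in cozero-sets with pseudocompact closure
(`closure_subset_interior_hewitt`, `exists_nhds_of_mem_interior_hewitt`). One direction separates a
zero-set from the complement of a cozero-set by a function extending to `βX`. The other uses that
every `f` is bounded on compact subsets of `υX`, and that a cozero-set on which all `f` are bounded
has pseudocompact closure. For (3), z-ultrafilters cluster at points of `βX`; the free ones with the
countable intersection property cluster only in `υX \ X`, and every point there arises in this way.
-/

lemma continuous_stoneExtension (f : C(X, ℝ)) : Continuous (stoneExtension f) :=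
  continuous_stoneCechExtend _

lemma stoneExtension_unit (f : C(X, ℝ)) (x : X) :
    stoneExtension f (stoneCechUnit x) = (f x : OnePoint ℝ) :=
  stoneCechExtend_stoneCechUnit _ x

lemma copyInBeta_subset_hewitt : copyInBeta X ⊆ hewittRealcompactification X := by
  rintro _ ⟨x, rfl⟩ f
  rw [stoneExtension_unit]
  exact OnePoint.coe_ne_infty _

/-- A continuous function is bounded on the trace of a compact subset of `υX`. -/
lemma exists_abs_le_of_isCompact_subset_hewitt {K : Set (StoneCech X)} (hK : IsCompact K)
    (hKX : K ⊆ hewittRealcompactification X) (f : C(X, ℝ)) :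
    ∃ M : ℝ, ∀ x, stoneCechUnit x ∈ K → |f x| ≤ M := by
  have himg : (((↑) : ℝ → OnePoint ℝ) '' (((↑) : ℝ → OnePoint ℝ) ⁻¹' (stoneExtension f '' K)))
      = stoneExtension f '' K := by
    rw [image_preimage_eq_iff]
    rintro _ ⟨q, hq, rfl⟩
    obtain ⟨r, hr⟩ := OnePoint.ne_infty_iff_exists.1 (hKX hq f)
    exact ⟨r, hr⟩
  have hcl := (hK.image (continuous_stoneExtension f)).isClosed
  -- A closed subset of `ℝ ∪ {∞}` that misses `∞` is compact in `ℝ`.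
  rw [← himg, OnePoint.isClosed_image_coe] at hcl
  obtain ⟨M, hM⟩ := hcl.2.isBounded.exists_norm_le
  exact ⟨M, fun x hx => hM (f x) ⟨_, hx, stoneExtension_unit f x⟩⟩

/-- The Stone extension of `f` is finite on the closure of a set on which `f` is bounded. -/
lemma stoneExtension_ne_infty_of_abs_le {S : Set X} {f : C(X, ℝ)} {M : ℝ}
    (hM : ∀ x ∈ S, |f x| ≤ M) {p : StoneCech X} (hp : p ∈ closure (stoneCechUnit '' S)) :
    stoneExtension f p ≠ OnePoint.infty := by
  have hcl : IsClosed (((↑) : ℝ → OnePoint ℝ) '' Metric.closedBall 0 M) :=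
    OnePoint.isClosed_image_coe.2 ⟨Metric.isClosed_closedBall, isCompact_closedBall 0 M⟩
  have hsub : closure (stoneCechUnit '' S) ⊆
      stoneExtension f ⁻¹' (((↑) : ℝ → OnePoint ℝ) '' Metric.closedBall 0 M) := by
    refine closure_minimal ?_ (hcl.preimage (continuous_stoneExtension f))
    rintro _ ⟨x, hx, rfl⟩
    exact ⟨f x, by simpa using hM x hx, (stoneExtension_unit f x).symm⟩
  obtain ⟨r, -, hr⟩ := hsub hp
  rw [← hr]
  exact OnePoint.coe_ne_infty _

/-- If `f` is at least `n` on `S n` and the closures of all `S n` contain `p`, then the Stone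
extension of `f` is infinite at `p`. -/
lemma stoneExtension_eq_infty {S : ℕ → Set X} {f : C(X, ℝ)}
    (hS : ∀ n, ∀ x ∈ S n, (n : ℝ) ≤ f x) {p : StoneCech X}
    (hp : ∀ n, p ∈ closure (stoneCechUnit '' S n)) :
    stoneExtension f p = OnePoint.infty := by
  by_contra h
  obtain ⟨r, hr⟩ := OnePoint.ne_infty_iff_exists.1 h
  obtain ⟨n, hn⟩ := exists_nat_gt r
  have hop : IsOpen (stoneExtension f ⁻¹' (((↑) : ℝ → OnePoint ℝ) '' Iio (n : ℝ))) :=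
    (OnePoint.isOpen_image_coe.2 isOpen_Iio).preimage (continuous_stoneExtension f)
  obtain ⟨_, ⟨t, ht, hte⟩, ⟨x, hx, rfl⟩⟩ := mem_closure_iff.1 (hp n) _ hop ⟨r, hn, hr⟩
  rw [stoneExtension_unit, OnePoint.coe_eq_coe] at hte
  have := hS n x hx
  rw [← hte] at this
  exact absurd this (not_le.2 ht)

lemma closure_image_inter_of_mem_nhds {S : Set X} {V : Set (StoneCech X)} {p : StoneCech X}
    (hp : p ∈ closure (stoneCechUnit '' S)) (hV : V ∈ 𝓝 p) :
    p ∈ closure (stoneCechUnit '' (S ∩ stoneCechUnit ⁻¹' V)) := by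
  rw [image_inter_preimage, mem_closure_iff_nhds]
  intro U hU
  obtain ⟨q, ⟨hqU, hqV⟩, hqS⟩ := mem_closure_iff_nhds.1 hp _ (inter_mem hU hV)
  exact ⟨q, hqU, hqS, hqV⟩

lemma mem_closure_image_preimage {V : Set (StoneCech X)} {p : StoneCech X} (hV : V ∈ 𝓝 p) :
    p ∈ closure (stoneCechUnit '' (stoneCechUnit ⁻¹' V : Set X)) := by
  have h : p ∈ closure (stoneCechUnit '' (univ : Set X)) := by
    rw [image_univ]; exact denseRange_stoneCechUnit p
  simpa using closure_image_inter_of_mem_nhds h hV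

lemma stoneCechUnit_mem_closure_image [T35Space X] {S : Set X} {x : X} :
    stoneCechUnit x ∈ closure (stoneCechUnit '' S) ↔ x ∈ closure S := by
  rw [isEmbedding_stoneCechUnit.closure_eq_preimage_closure_image S, mem_preimage]

end StoneExtension

/-! ### Zero-sets and their closures in `βX`. -/

section ZeroSets

variable {X : Type u} [TopologicalSpace X]

lemma IsZeroSet.isClosed {Z : Set X} (h : IsZeroSet Z) : IsClosed Z := by
  obtain ⟨f, rfl⟩ := h
  exact isClosed_eq f.continuous continuous_const

lemma IsZeroSet.inter {Z W : Set X} (hZ : IsZeroSet Z) (hW : IsZeroSet W) :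
    IsZeroSet (Z ∩ W) := by
  obtain ⟨f, rfl⟩ := hZ
  obtain ⟨g, rfl⟩ := hW
  refine ⟨⟨fun x => |f x| + |g x|, by fun_prop⟩, ?_⟩
  ext x
  simp [add_eq_zero_iff_of_nonneg]

lemma isZeroSet_univ : IsZeroSet (univ : Set X) := ⟨0, by simp⟩

lemma isZeroSet_le (f : C(X, ℝ)) (c : ℝ) : IsZeroSet {x | c ≤ f x} :=
  ⟨⟨fun x => max (c - f x) 0, by fun_prop⟩, by ext x; simp⟩

lemma isCozeroSet_lt (f : C(X, ℝ)) (c : ℝ) : IsCozeroSet {x | c < f x} :=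
  ⟨⟨fun x => max (f x - c) 0, by fun_prop⟩, by ext x; simp⟩

/-- A zero-set inside a cozero-set: the cozero-set contains the trace of a neighbourhood of the
closure of the zero-set in `βX`. -/
lemma exists_isOpen_of_isZeroSet_subset_isCozeroSet {Z C : Set X} (hZ : IsZeroSet Z)
    (hC : IsCozeroSet C) (hZC : Z ⊆ C) :
    ∃ U : Set (StoneCech X), IsOpen U ∧ closure (stoneCechUnit '' Z) ⊆ U ∧
      stoneCechUnit ⁻¹' U ⊆ C := by
  obtain ⟨f, rfl⟩ := hZ
  obtain ⟨g, rfl⟩ := hC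
  have hpos : ∀ x, 0 < |f x| + |g x| := by
    intro x
    by_cases hx : f x = 0
    · have : g x ≠ 0 := hZC hx
      positivity
    · positivity
  -- `k` is 0 on the zero-set and 1 off the cozero-set; its values lie in a compact space, so it
  -- extends to `βX`.
  let k : X → unitInterval := fun x => ⟨|f x| / (|f x| + |g x|), by
    have := hpos x
    constructor
    · positivity
    · rw [div_le_one this]; linarith [abs_nonneg (g x)]⟩
  have hk : Continuous k := by
    refine Continuous.subtype_mk ?_ _
    exact Continuous.div (by fun_prop) (by fun_prop) fun x => (hpos x).ne'
  refine ⟨stoneCechExtend hk ⁻¹' Iio 1, isOpen_Iio.preimage (continuous_stoneCechExtend hk), ?_, ?_⟩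
  · have : closure (stoneCechUnit '' {x | f x = 0}) ⊆ stoneCechExtend hk ⁻¹' {0} := by
      refine closure_minimal ?_ (isClosed_singleton.preimage (continuous_stoneCechExtend hk))
      rintro _ ⟨x, hx, rfl⟩
      have hx' : f x = 0 := hx
      simp [k, hx']
    refine this.trans (preimage_mono ?_)
    rintro _ rfl
    exact zero_lt_one (α := unitInterval)
  · intro x hx hg
    rw [mem_preimage, mem_preimage, stoneCechExtend_stoneCechUnit, mem_Iio] at hx
    have h1 : |f x| / (|f x| + |g x|) < 1 := hx
    have h2 := hpos x
    rw [hg, abs_zero, add_zero] at h1 h2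
    rw [div_self h2.ne'] at h1
    exact lt_irrefl _ h1

lemma exists_continuous_eq_one_of_isOpen {U : Set (StoneCech X)} (hU : IsOpen U)
    {p : StoneCech X} (hp : p ∈ U) :
    ∃ g : C(StoneCech X, ℝ), g p = 1 ∧ ∀ q, 0 < g q → q ∈ U := by
  obtain ⟨g, hg0, hg1, -⟩ := exists_continuous_zero_one_of_isClosed hU.isClosed_compl
    (isClosed_singleton (x := p)) (by simpa using hp)
  refine ⟨g, hg1 rfl, fun q hq => ?_⟩
  by_contra hqU
  have : g q = 0 := hg0 hqU
  exact hq.ne' this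

/-- Every open neighbourhood of a point of `βX` contains a neighbourhood whose trace is a zero-set
of `X`. -/
lemma exists_isZeroSet_mem_nhds {U : Set (StoneCech X)} (hU : IsOpen U)
    {p : StoneCech X} (hp : p ∈ U) :
    ∃ V ∈ 𝓝 p, V ⊆ U ∧ IsZeroSet (stoneCechUnit ⁻¹' V : Set X) := by
  obtain ⟨g, hg1, hg⟩ := exists_continuous_eq_one_of_isOpen hU hp
  refine ⟨{q | 1 / 2 ≤ g q}, ?_, fun q hq => hg q ?_, ?_⟩
  · exact g.continuous.continuousAt.eventually (le_mem_nhds (by rw [hg1]; norm_num))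
  · exact lt_of_lt_of_le (by norm_num) hq
  · exact isZeroSet_le (g.comp ⟨stoneCechUnit, continuous_stoneCechUnit⟩) (1 / 2)

/-- Otherwise `Z` can be cut down near `p` to a zero-set disjoint from `W`, and disjoint zero-sets
have disjoint closures in `βX`. -/
lemma mem_closure_image_inter_of_isZeroSet {Z W : Set X} (hZ : IsZeroSet Z) (hW : IsZeroSet W)
    {p : StoneCech X} (hpZ : p ∈ closure (stoneCechUnit '' Z))
    (hpW : p ∈ closure (stoneCechUnit '' W)) : p ∈ closure (stoneCechUnit '' (Z ∩ W)) := by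
  by_contra hp
  obtain ⟨V, hV, hVU, hVz⟩ := exists_isZeroSet_mem_nhds isClosed_closure.isOpen_compl hp
  obtain ⟨g, hg⟩ := hW
  have hsub : Z ∩ stoneCechUnit ⁻¹' V ⊆ {x | g x ≠ 0} := by
    rintro x ⟨hxZ, hxV⟩ hx
    exact hVU hxV (subset_closure ⟨x, ⟨hxZ, hg ▸ hx⟩, rfl⟩)
  obtain ⟨U, hUo, hU, hUC⟩ :=
    exists_isOpen_of_isZeroSet_subset_isCozeroSet (hZ.inter hVz) ⟨g, rfl⟩ hsub
  obtain ⟨_, hxU, x, hxW, rfl⟩ :=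
    mem_closure_iff.1 hpW U hUo (hU (closure_image_inter_of_mem_nhds hpZ hV))
  rw [hg] at hxW
  exact hUC hxU hxW

end ZeroSets

/-! ### Pseudocompact closures and the interior of `υX`. -/

section Pseudocompact

variable {X : Type u} [TopologicalSpace X]

/-- Reals `a n` are dominated at all points `t ≥ n` by a continuous function. -/
lemma exists_continuous_dominating (a : ℕ → ℝ) :
    ∃ F : C(ℝ, ℝ), ∀ (t : ℝ) (n : ℕ), (n : ℝ) ≤ t → a n ≤ F t := by
  obtain ⟨F, hF⟩ := exists_continuous_forall_mem_convex_of_local_const (X := ℝ) (E := ℝ)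
    (t := fun t => ⋂ n : ℕ, ⋂ _ : (n : ℝ) ≤ t, Ici (a n))
    (fun t => convex_iInter fun n => convex_iInter fun _ => convex_Ici _) (fun t => by
      -- For `s < t + 1` only finitely many `n ≤ s` impose a bound, so a constant works locally;
      -- convexity glues the constants.
      refine ⟨∑ n ∈ Finset.range (⌈t + 1⌉₊ + 1), |a n|, ?_⟩
      filter_upwards [Iio_mem_nhds (lt_add_one t)] with s hs
      simp only [mem_iInter, mem_Ici]
      intro n hn
      refine (le_abs_self _).trans (Finset.single_le_sum (f := fun n => |a n|)
        (fun i _ => abs_nonneg _) ?_)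
      rw [Finset.mem_range, Nat.lt_succ_iff]
      have : (n : ℝ) ≤ ⌈t + 1⌉₊ := hn.trans (hs.le.trans (Nat.le_ceil _))
      exact_mod_cast this)
  refine ⟨F, fun t n hn => ?_⟩
  have := hF t
  simp only [mem_iInter, mem_Ici] at this
  exact this n hn

/-- The closure of a cozero-set on which every continuous function on `X` is bounded is
pseudocompact. -/
lemma IsCozeroSet.isPseudocompactSpace_closure {C : Set X} (hC : IsCozeroSet C)
    (hb : ∀ h : C(X, ℝ), ∃ M : ℝ, ∀ x ∈ C, |h x| ≤ M) : IsPseudocompactSpace (closure C) := by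
  classical
  obtain ⟨g, rfl⟩ := hC
  set C : Set X := {x | g x ≠ 0} with hCdef
  intro f
  by_contra hunb
  have hex : ∀ n : ℕ, ∃ x : closure C, (x : X) ∈ C ∧ (n : ℝ) ≤ |f x| := by
    intro n
    by_contra! hn
    apply hunb
    refine (Metric.isBounded_closedBall (x := (0 : ℝ)) (r := n)).subset ?_
    rintro _ ⟨y, rfl⟩
    have hd : Dense {x : closure C | (x : X) ∈ C} := by
      intro x
      rw [closure_subtype]
      have : ((↑) '' {x : closure C | (x : X) ∈ C} : Set X) = C := by
        ext z
        constructor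
        · rintro ⟨w, hw, rfl⟩; exact hw
        · intro hz; exact ⟨⟨z, subset_closure hz⟩, hz, rfl⟩
      rw [this]
      exact x.2
    have hcl : IsClosed {x : closure C | |f x| ≤ n} :=
      isClosed_le (by fun_prop) continuous_const
    have : |f y| ≤ n := closure_minimal (fun x hx => (hn x hx).le) hcl (hd y)
    simpa using this
  choose x hxC hxf using hex
  -- Chosen so that `F |f| * |g|` is at least `n` at `x n`, while the factor `|g|` lets it extend
  -- continuously by zero outside `C`.
  obtain ⟨F, hF⟩ := exists_continuous_dominating fun n => n / |g (x n)|
  let k : X → ℝ := fun z => if hz : z ∈ closure C then F |f ⟨z, hz⟩| * |g z| else 0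
  have hk : ContinuousOn k (closure C) := by
    rw [continuousOn_iff_continuous_domRestrict]
    have : (closure C).domRestrict k = fun z : closure C => F |f z| * |g z| := by
      ext z
      exact dif_pos z.2
    rw [this]
    fun_prop
  have hCo : IsOpen C := isOpen_ne_fun g.continuous continuous_const
  have hcont : Continuous (C.piecewise k fun _ => 0) := by
    refine continuous_piecewise ?_ hk continuousOn_const
    intro a ha
    rw [hCo.frontier_eq] at ha
    have hga : g a = 0 := by simpa [hCdef] using ha.2
    simp [k, hga]
  obtain ⟨M, hM⟩ := hb ⟨_, hcont⟩
  obtain ⟨n, hn⟩ := exists_nat_gt M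
  have h1 := hM (x n) (hxC n)
  have hg : 0 < |g (x n)| := abs_pos.2 (hxC n)
  have h2 : (C.piecewise k fun _ => 0) (x n : X) = F |f (x n)| * |g (x n)| := by
    rw [piecewise_eq_of_mem _ _ _ (hxC n)]
    simp [k]
  have h3 := hF _ n (hxf n)
  rw [div_le_iff₀ hg] at h3
  have h4 := (le_abs_self _).trans h1
  rw [ContinuousMap.coe_mk, h2] at h4
  linarith

lemma closure_subset_hewitt_of_isPseudocompactSpace {C : Set X}
    (hC : IsPseudocompactSpace (closure C)) :
    closure (stoneCechUnit '' C) ⊆ hewittRealcompactification X := by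
  intro p hp f
  obtain ⟨M, hM⟩ := (hC (f.restrict (closure C))).exists_norm_le
  exact stoneExtension_ne_infty_of_abs_le
    (fun x hx => hM _ ⟨⟨x, subset_closure hx⟩, rfl⟩) hp

/-- The closure in `βX` of a zero-set contained in a cozero-set with pseudocompact closure lies in
the interior of `υX`. -/
lemma closure_subset_interior_hewitt {Z C : Set X} (hZ : IsZeroSet Z)
    (hC : IsCozeroSetWithPseudocompactClosure C) (hZC : Z ⊆ C) :
    closure (stoneCechUnit '' Z) ⊆ interior (hewittRealcompactification X) := by
  obtain ⟨U, hUo, hU, hUC⟩ := exists_isOpen_of_isZeroSet_subset_isCozeroSet hZ hC.1 hZC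
  refine hU.trans (interior_maximal ?_ hUo)
  intro q hq
  exact closure_subset_hewitt_of_isPseudocompactSpace hC.2
    (closure_mono (image_mono hUC) (mem_closure_image_preimage (hUo.mem_nhds hq)))

/-- A point interior to `υX` has a neighbourhood whose trace is a zero-set contained in a
cozero-set with pseudocompact closure. -/
lemma exists_nhds_of_mem_interior_hewitt {p : StoneCech X}
    (hp : p ∈ interior (hewittRealcompactification X)) :
    ∃ V ∈ 𝓝 p, IsZeroSet (stoneCechUnit ⁻¹' V : Set X) ∧
      ∃ C : Set X, IsCozeroSetWithPseudocompactClosure C ∧ stoneCechUnit ⁻¹' V ⊆ C := by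
  obtain ⟨g, hg1, hg⟩ := exists_continuous_eq_one_of_isOpen isOpen_interior hp
  let g' : C(X, ℝ) := g.comp ⟨stoneCechUnit, continuous_stoneCechUnit⟩
  -- The levels 1/3 and 2/3 nest a zero-set trace in a cozero-set, itself inside the trace of a
  -- compact subset of `υX`.
  have hK : IsCompact {q | 1 / 3 ≤ g q} :=
    (isClosed_le continuous_const g.continuous).isCompact
  have hKX : {q | 1 / 3 ≤ g q} ⊆ hewittRealcompactification X := fun q hq =>
    interior_subset (hg q (lt_of_lt_of_le (by norm_num) hq))
  have hC : IsCozeroSet {x | 1 / 3 < g' x} := isCozeroSet_lt g' _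
  refine ⟨{q | 2 / 3 ≤ g q}, ?_, isZeroSet_le g' _, {x | 1 / 3 < g' x}, ⟨hC, ?_⟩, ?_⟩
  · exact g.continuous.continuousAt.eventually (le_mem_nhds (by rw [hg1]; norm_num))
  · refine hC.isPseudocompactSpace_closure fun h => ?_
    obtain ⟨M, hM⟩ := exists_abs_le_of_isCompact_subset_hewitt hK hKX h
    exact ⟨M, fun x hx => hM x (show (1 / 3 : ℝ) ≤ g' x from le_of_lt hx)⟩
  · intro x hx
    exact lt_of_lt_of_le (by norm_num) (show (2 / 3 : ℝ) ≤ g' x from hx)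

lemma isPseudocompactSpace_iff_hewitt_eq_univ :
    IsPseudocompactSpace X ↔ hewittRealcompactification X = univ := by
  constructor
  · intro h
    refine eq_univ_of_forall fun p f => ?_
    obtain ⟨M, hM⟩ := (h f).exists_norm_le
    refine stoneExtension_ne_infty_of_abs_le (S := univ) (fun x _ => hM _ ⟨x, rfl⟩) ?_
    rw [image_univ]
    exact denseRange_stoneCechUnit p
  · intro h f
    obtain ⟨M, hM⟩ := exists_abs_le_of_isCompact_subset_hewitt isCompact_univ h.ge f
    refine (Metric.isBounded_closedBall (x := (0 : ℝ)) (r := M)).subset ?_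
    rintro _ ⟨x, rfl⟩
    simpa using hM x trivial

end Pseudocompact

/-! ### z-ultrafilters and points of `βX`. -/

section ZUltrafilters

variable {X : Type u} [TopologicalSpace X]

/-- A zero-set meeting every member of a z-ultrafilter belongs to it. -/
lemma IsZUltrafilter.mem_of_forall_inter_nonempty {F : Set (Set X)} (hF : IsZUltrafilter F)
    {Z : Set X} (hZ : IsZeroSet Z) (h : ∀ W ∈ F, (Z ∩ W).Nonempty) : Z ∈ F := by
  -- The z-filter generated by `F` and `Z`; maximality of `F` absorbs it.
  have hG : IsZFilter {A : Set X | IsZeroSet A ∧ ∃ W ∈ F, Z ∩ W ⊆ A} := by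
    refine ⟨fun A hA => hA.1, ?_, ?_, ?_, ?_⟩
    · obtain ⟨W, hW⟩ := hF.prop.nonempty
      exact ⟨W, hF.prop.isZeroSet W hW, W, hW, inter_subset_right⟩
    · rintro ⟨-, W, hW, hsub⟩
      exact (h W hW).not_subset_empty hsub
    · rintro A ⟨hA, W, hW, hWA⟩ B ⟨hB, W', hW', hWB⟩
      exact ⟨hA.inter hB, W ∩ W', hF.prop.inter_mem W hW W' hW', fun x hx =>
        ⟨hWA ⟨hx.1, hx.2.1⟩, hWB ⟨hx.1, hx.2.2⟩⟩⟩
    · rintro A ⟨-, W, hW, hWA⟩ B hB hAB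
      exact ⟨hB, W, hW, hWA.trans hAB⟩
  obtain ⟨W, hW⟩ := hF.prop.nonempty
  exact hF.le_of_ge hG (fun A hA => ⟨hF.prop.isZeroSet A hA, A, hA, inter_subset_right⟩)
    ⟨hZ, W, hW, inter_subset_left⟩

lemma IsZFilter.exists_forall_mem_closure {F : Set (Set X)} (hF : IsZFilter F) :
    ∃ p : StoneCech X, ∀ Z ∈ F, p ∈ closure (stoneCechUnit '' Z) := by
  obtain ⟨W, hW⟩ := hF.nonempty
  have : Nonempty F := ⟨⟨W, hW⟩⟩
  obtain ⟨p, hp⟩ := IsCompact.nonempty_iInter_of_directed_nonempty_isCompact_isClosed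
    (fun Z : F => closure (stoneCechUnit '' (Z : Set X)))
    (fun A B => ⟨⟨A ∩ B, hF.inter_mem A A.2 B B.2⟩,
      closure_mono (image_mono inter_subset_left), closure_mono (image_mono inter_subset_right)⟩)
    (fun Z => ((nonempty_iff_ne_empty.2 fun h => hF.empty_notMem (h ▸ Z.2)).image _).closure)
    (fun Z => isClosed_closure.isCompact) (fun Z => isClosed_closure)
  exact ⟨p, fun Z hZ => mem_iInter.1 hp ⟨Z, hZ⟩⟩

/-- A z-ultrafilter contains the zero-set traces of neighbourhoods of a point it clusters at. -/
lemma IsZUltrafilter.preimage_mem {F : Set (Set X)} (hF : IsZUltrafilter F) {p : StoneCech X}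
    (hp : ∀ Z ∈ F, p ∈ closure (stoneCechUnit '' Z)) {V : Set (StoneCech X)} (hV : V ∈ 𝓝 p)
    {Z : Set X} (hZ : IsZeroSet Z) (hVZ : stoneCechUnit ⁻¹' V ⊆ Z) : Z ∈ F := by
  refine hF.mem_of_forall_inter_nonempty hZ fun W hW => ?_
  obtain ⟨_, hxV, x, hxW, rfl⟩ := mem_closure_iff_nhds.1 (hp W hW) V hV
  exact ⟨x, hVZ hxV, hxW⟩

/-- A z-ultrafilter with the countable intersection property clusters only at points of `υX`. -/
lemma IsZUltrafilter.mem_hewitt {F : Set (Set X)} (hF : IsZUltrafilter F)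
    (hcip : HasCountableIntersectionProperty F) {p : StoneCech X}
    (hp : ∀ Z ∈ F, p ∈ closure (stoneCechUnit '' Z)) : p ∈ hewittRealcompactification X := by
  intro f hf
  -- These countably many sets have empty intersection, contradicting `hcip`.
  have hmem : ∀ n : ℕ, {x | (n : ℝ) ≤ |f x|} ∈ F := by
    intro n
    have hcl : IsClosed (((↑) : ℝ → OnePoint ℝ) '' Metric.closedBall 0 n) :=
      OnePoint.isClosed_image_coe.2 ⟨Metric.isClosed_closedBall, isCompact_closedBall 0 _⟩
    refine hF.preimage_mem hp
      ((hcl.preimage (continuous_stoneExtension f)).isOpen_compl.mem_nhds ?_)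
      (isZeroSet_le ⟨fun x => |f x|, by fun_prop⟩ n) ?_
    · rw [mem_compl_iff, mem_preimage, hf]
      exact OnePoint.infty_notMem_image_coe
    · intro x hx
      by_contra hlt
      exact hx ⟨f x, by simpa using (not_le.1 hlt).le, (stoneExtension_unit f x).symm⟩
  obtain ⟨x, hx⟩ := hcip (range fun n : ℕ => {x | (n : ℝ) ≤ |f x|})
    (by rintro _ ⟨n, rfl⟩; exact hmem n) (countable_range _)
  obtain ⟨n, hn⟩ := exists_nat_gt |f x|
  have : (n : ℝ) ≤ |f x| := hx _ ⟨n, rfl⟩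
  linarith

/-- The family of zero-sets of `X` whose closure in `βX` contains `p`. -/
def zeroSetsAt (p : StoneCech X) : Set (Set X) :=
  {Z | IsZeroSet Z ∧ p ∈ closure (stoneCechUnit '' Z)}

lemma isZUltrafilter_zeroSetsAt (p : StoneCech X) : IsZUltrafilter (zeroSetsAt p) := by
  refine ⟨⟨fun Z hZ => hZ.1, ?_, ?_, ?_, ?_⟩, ?_⟩
  · refine ⟨univ, isZeroSet_univ, ?_⟩
    rw [image_univ]
    exact denseRange_stoneCechUnit p
  · rintro ⟨-, h⟩
    simp at h
  · exact fun Z hZ W hW =>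
      ⟨hZ.1.inter hW.1, mem_closure_image_inter_of_isZeroSet hZ.1 hW.1 hZ.2 hW.2⟩
  · exact fun Z hZ W hW hZW => ⟨hW, closure_mono (image_mono hZW) hZ.2⟩
  · intro G hG hFG Z hZ
    refine ⟨hG.isZeroSet Z hZ, ?_⟩
    by_contra hp
    obtain ⟨V, hV, hVU, hVz⟩ := exists_isZeroSet_mem_nhds isClosed_closure.isOpen_compl hp
    have hmem := hG.inter_mem Z hZ _ (hFG ⟨hVz, mem_closure_image_preimage hV⟩)
    have hempty : Z ∩ stoneCechUnit ⁻¹' V = ∅ := by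
      refine eq_empty_of_forall_notMem ?_
      rintro x ⟨hxZ, hxV⟩
      exact hVU hxV (subset_closure ⟨x, hxZ, rfl⟩)
    exact hG.empty_notMem (hempty ▸ hmem)

lemma isFreeFamily_zeroSetsAt {p : StoneCech X} (hp : p ∉ copyInBeta X) :
    IsFreeFamily (zeroSetsAt p) := by
  refine eq_empty_of_forall_notMem fun x hx => ?_
  have hne : p ∈ ({stoneCechUnit x}ᶜ : Set (StoneCech X)) := fun h => hp ⟨x, h.symm⟩
  obtain ⟨V, hV, hVU, hVz⟩ := exists_isZeroSet_mem_nhds isOpen_compl_singleton hne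
  exact hVU (hx _ ⟨hVz, mem_closure_image_preimage hV⟩) rfl

/-- If zero-sets of `f n` in the family had empty intersection, `∑ min |f n| (2⁻ⁿ)` would be
positive, and its reciprocal, large on finite intersections, would be infinite at `p`. -/
lemma hasCountableIntersectionProperty_zeroSetsAt {p : StoneCech X}
    (hp : p ∈ hewittRealcompactification X) :
    HasCountableIntersectionProperty (zeroSetsAt p) := by
  intro S hS hSc
  have hfil := (isZUltrafilter_zeroSetsAt p).prop
  have huniv : univ ∈ zeroSetsAt p := by
    obtain ⟨W, hW⟩ := hfil.nonempty
    exact hfil.mem_of_superset W hW _ isZeroSet_univ (subset_univ _)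
  -- Adding `univ` makes the family nonempty, hence enumerable by `ℕ`.
  obtain ⟨Z, hZ⟩ := (hSc.insert univ).exists_eq_range (insert_nonempty _ _)
  have hZmem : ∀ n, Z n ∈ zeroSetsAt p := fun n =>
    (insert_subset huniv hS) (hZ ▸ mem_range_self n)
  choose f hf using fun n => (hZmem n).1
  by_contra hne
  have hex : ∀ x, ∃ n, f n x ≠ 0 := by
    intro x
    by_contra! hx
    refine hne ⟨x, fun A hA => ?_⟩
    obtain ⟨n, rfl⟩ : A ∈ range Z := hZ ▸ mem_insert_of_mem _ hA
    rw [hf n]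
    exact hx n
  let u : ℕ → ℝ := fun n => (1 / 2) ^ n
  let v : ℕ → X → ℝ := fun n x => min |f n x| (u n)
  have hu : Summable u := summable_geometric_two
  have hu0 : ∀ n, 0 < u n := fun n => by positivity
  have hv0 : ∀ n x, 0 ≤ v n x := fun n x => le_min (abs_nonneg _) (hu0 n).le
  have hvu : ∀ n x, ‖v n x‖ ≤ u n := fun n x => by
    rw [Real.norm_of_nonneg (hv0 n x)]; exact min_le_right _ _
  have hvs : ∀ x, Summable fun n => v n x := fun x =>
    Summable.of_norm_bounded hu fun n => hvu n x
  have hcont : Continuous fun x => ∑' n, v n x :=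
    continuous_tsum (fun n => by fun_prop) hu hvu
  have hpos : ∀ x, 0 < ∑' n, v n x := by
    intro x
    obtain ⟨n, hn⟩ := hex x
    exact (hvs x).tsum_pos (fun i => hv0 i x) n (lt_min (abs_pos.2 hn) (hu0 n))
  have htail : ∀ n : ℕ, ∃ N, ∑' i, u (i + N) < 1 / ((n : ℝ) + 1) := fun n =>
    ((tendsto_sum_nat_add u).eventually (Iio_mem_nhds (by positivity))).exists
  choose N hN using htail
  have hinter : ∀ m : ℕ, {x | ∀ i < m, f i x = 0} ∈ zeroSetsAt p := by
    intro m
    induction m with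
    | zero => simpa using huniv
    | succ m ih =>
      have := hfil.inter_mem _ ih _ (hZmem m)
      rw [hf m] at this
      convert this using 1
      ext x
      exact Nat.forall_lt_succ_right
  refine hp ⟨fun x => (∑' n, v n x)⁻¹, hcont.inv₀ fun x => (hpos x).ne'⟩
    (stoneExtension_eq_infty (S := fun n => {x | ∀ i < N n, f i x = 0}) ?_ fun n => (hinter _).2)
  intro n x hx
  have hle : ∑' i, v i x ≤ ∑' i, u (i + N n) := by
    rw [← (hvs x).sum_add_tsum_nat_add (N n), Finset.sum_eq_zero, zero_add]
    · exact ((summable_nat_add_iff (N n)).2 (hvs x)).tsum_le_tsum (fun i => min_le_right _ _)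
        ((summable_nat_add_iff (N n)).2 hu)
    · intro i hi
      have : f i x = 0 := hx i (Finset.mem_range.1 hi)
      simp [v, this, (hu0 i).le]
  have hlt := hle.trans_lt (hN n)
  have hlt' := one_div_lt_one_div_of_lt (hpos x) hlt
  rw [one_div_one_div, one_div] at hlt'
  rw [ContinuousMap.coe_mk]
  linarith

end ZUltrafilters

/-! ### The three characterizations. -/

theorem theorem2p5 (X : Type u) [TopologicalSpace X] [T35Space X] :
    (zetaExtension X = copyInBeta X ↔ IsPseudocompactSpace X) ∧
    (zetaExtension X = Set.univ ↔
      ¬ ∃ C : Set X, IsCozeroSetWithPseudocompactClosure C ∧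
        ∃ Z : Set X, IsZeroSet Z ∧ ¬ IsCompact Z ∧ Z ⊆ C) ∧
    List.TFAE [
      zetaExtension X = alphaExtension X,
      hewittRealcompactification X \ copyInBeta X ⊆ interior (hewittRealcompactification X),
      ∀ F : Set (Set X), IsZUltrafilter F → IsFreeFamily F →
        HasCountableIntersectionProperty F →
          ∃ Z ∈ F, ∃ C : Set X, IsCozeroSetWithPseudocompactClosure C ∧ Z ⊆ C] := by
  refine ⟨?_, ?_, ?_⟩
  · rw [isPseudocompactSpace_iff_hewitt_eq_univ, zetaExtension, union_eq_left]
    constructor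
    · intro h
      refine eq_univ_of_forall fun p => ?_
      by_contra hp
      exact hp (copyInBeta_subset_hewitt (h (subset_closure hp)))
    · intro h
      simp [h]
  · rw [zetaExtension, closure_compl]
    constructor
    · rintro h ⟨C, hC, Z, hZ, hZc, hZC⟩
      apply hZc
      have hsub : closure (stoneCechUnit '' Z) ⊆ (stoneCechUnit '' Z : Set (StoneCech X)) := by
        intro p hp
        rcases h.ge (mem_univ p) with ⟨x, rfl⟩ | hpi
        · rw [stoneCechUnit_mem_closure_image, hZ.isClosed.closure_eq] at hp
          exact ⟨x, hp, rfl⟩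
        · exact absurd (closure_subset_interior_hewitt hZ hC hZC hp) hpi
      rw [isEmbedding_stoneCechUnit.isCompact_iff]
      exact (isClosed_of_closure_subset hsub).isCompact
    · intro h
      refine eq_univ_of_forall fun p => ?_
      by_contra hp
      rw [mem_union, not_or, mem_compl_iff, not_not] at hp
      obtain ⟨V, hV, hVz, C, hC, hVC⟩ := exists_nhds_of_mem_interior_hewitt hp.2
      -- A compact trace would be closed in `βX`, forcing `p` into `X`.
      refine h ⟨C, hC, _, hVz, fun hc => hp.1 ?_, hVC⟩
      have hp' := mem_closure_image_preimage hV
      rw [(hc.image continuous_stoneCechUnit).isClosed.closure_eq] at hp'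
      exact image_subset_range _ _ hp'
  · tfae_have 1 ↔ 2 := by
      rw [zetaExtension, alphaExtension, closure_compl]
      constructor
      · rintro h p ⟨hp, hpX⟩
        by_contra hpi
        rcases h.le (Or.inr hpi) with h1 | h1
        · exact hpX h1
        · exact h1 hp
      · intro h
        refine Subset.antisymm ?_ (union_subset_union_right _ (compl_subset_compl.2 interior_subset))
        rintro p (hp | hp)
        · exact Or.inl hp
        · by_contra hn
          rw [mem_union, not_or, mem_compl_iff, not_not] at hn
          exact hp (h ⟨hn.2, hn.1⟩)
    tfae_have 2 → 3 := by
      intro h F hF hfree hcip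
      obtain ⟨p, hp⟩ := hF.prop.exists_forall_mem_closure
      have hpX : p ∉ copyInBeta X := by
        rintro ⟨x, rfl⟩
        have : x ∈ ⋂₀ F := fun Z hZ => by
          have := stoneCechUnit_mem_closure_image.1 (hp Z hZ)
          rwa [(hF.prop.isZeroSet Z hZ).isClosed.closure_eq] at this
        rw [hfree] at this
        exact this
      obtain ⟨V, hV, hVz, C, hC, hVC⟩ :=
        exists_nhds_of_mem_interior_hewitt (h ⟨hF.mem_hewitt hcip hp, hpX⟩)
      exact ⟨_, hF.preimage_mem hp hV hVz Subset.rfl, C, hC, hVC⟩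
    tfae_have 3 → 2 := by
      rintro h p ⟨hp, hpX⟩
      obtain ⟨Z, hZ, C, hC, hZC⟩ := h _ (isZUltrafilter_zeroSetsAt p)
        (isFreeFamily_zeroSetsAt hpX) (hasCountableIntersectionProperty_zeroSetsAt hp)
      exact closure_subset_interior_hewitt hZ.1 hC hZC hZ.2
    tfae_finish
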